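/- Let $\Omega\subset\mathbb R^3$ be a bounded domain (open, connected) with smooth boundary $\Gamma$. (i) Let $B:\mathbb R^3\to\mathbb R^3$ be a continuous vector field such that $\nabla\times B=0$ and $\nabla\cdot B=0$ in $\mathbb R^3\setminus\Gamma$, and $B(x)=O(|x|^{-1})$ as $x\to\infty$. Then $B\equiv 0$. (ii) Consequently, for given vector fields $J^-$ in $\Omega$ and $B^{\mathrm{in}}$ on $\Gamma$, the transmission problem $$\nabla\times B^-=J^-,\quad \nabla\cdot B^-=0\quad\text{in }\Omega,$$ $$\nabla\times B^+=0,\quad \nabla\cdot B^+=0\quad\text{in }\mathbb R^3\setminus\overline\Omega,\qquad |B^+(x)|=O(|x|^{-1})\ \text{ as } x\to\infty,$$ $$B^--B^+=B^{\mathrm{in}}\quad\text{on }\Gamma$$ has at most one solution $(B^-,B^+)$ with $B^-$ continuous on $\overline\Omega$ and $B^+$ continuous on $\mathbb R^3\setminus\Omega$. In both parts the differential equations may hold either in the classical sense (the field being differentiable at each point of the open set in question) or in the sense of distributions. -/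

import Mathlib

open MeasureTheory Set
open scoped ContDiff

noncomputable section

/-- Euclidean three-space. -/
abbrev E3 : Type := EuclideanSpace ℝ (Fin 3)

/-- The partial derivative `∂ⱼ Bᵢ` of a vector field at the point `x`. -/
def partialDeriv (j : Fin 3) (B : E3 → E3) (i : Fin 3) (x : E3) : ℝ :=
  (fderiv ℝ B x (EuclideanSpace.single j 1)) i

/-- The divergence of a (differentiable) vector field. -/
def divergence (B : E3 → E3) (x : E3) : ℝ :=
  ∑ i, partialDeriv i B i x

/-- The curl of a (differentiable) vector field. -/
def curl (B : E3 → E3) (x : E3) : E3 :=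
  !₂[partialDeriv 1 B 2 x - partialDeriv 2 B 1 x,
     partialDeriv 2 B 0 x - partialDeriv 0 B 2 x,
     partialDeriv 0 B 1 x - partialDeriv 1 B 0 x]

/-- `φ` is a test function on `U`: smooth, with compact support contained in `U`. -/
structure IsTestOn {F : Type*} [NormedAddCommGroup F] [NormedSpace ℝ F]
    (U : Set E3) (φ : E3 → F) : Prop where
  smooth : ContDiff ℝ ∞ φ
  compact : HasCompactSupport φ
  support : tsupport φ ⊆ U

/-- `∇ × B = J` and `∇ · B = 0` in the open set `U`, in the classical sense. -/
structure ClassicalDivCurl (U : Set E3) (B J : E3 → E3) : Prop where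
  differentiable : ∀ x ∈ U, DifferentiableAt ℝ B x
  curl_eq : ∀ x ∈ U, curl B x = J x
  div_eq : ∀ x ∈ U, divergence B x = 0

/-- `∇ × B = J` and `∇ · B = 0` in the open set `U`, in the sense of distributions. -/
structure WeakDivCurl (U : Set E3) (B J : E3 → E3) : Prop where
  locallyIntegrable_field : LocallyIntegrableOn B U
  locallyIntegrable_curl : LocallyIntegrableOn J U
  curl_eq : ∀ ψ : E3 → E3, IsTestOn U ψ →
    ∫ x, inner ℝ (B x) (curl ψ x) = ∫ x, inner ℝ (J x) (ψ x)
  div_eq : ∀ φ : E3 → ℝ, IsTestOn U φ →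
    ∫ x, inner ℝ (B x) (gradient φ x) = 0

/-- `∇ × B = J` and `∇ · B = 0` in the open set `U`, classically or as distributions. -/
def DivCurl (U : Set E3) (B J : E3 → E3) : Prop :=
  ClassicalDivCurl U B J ∨ WeakDivCurl U B J

/-- A bounded domain with smooth boundary: near each of its boundary points it is the sublevel set
`{ρ < 0}` of a smooth function `ρ` whose differential does not vanish at that point. -/
structure IsSmoothBoundedDomain (Ω : Set E3) : Prop where
  isOpen : IsOpen Ω
  isConnected : IsConnected Ω
  isBounded : Bornology.IsBounded Ω
  smooth_boundary : ∀ p ∈ frontier Ω, ∃ (U : Set E3) (ρ : E3 → ℝ),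
    IsOpen U ∧ p ∈ U ∧ ContDiffOn ℝ ∞ ρ U ∧ fderiv ℝ ρ p ≠ 0 ∧ Ω ∩ U = {x ∈ U | ρ x < 0}

/-- `B(x) = O(|x|⁻¹)` as `x → ∞`. -/
def DecaysAtInfinity (B : E3 → E3) : Prop :=
  B =O[Bornology.cobounded E3] fun x => ‖x‖⁻¹

/-- The pair `(Bm, Bp)` solves the transmission problem in `Ω` with the current `J` in `Ω` and the
jump `Bin` on the boundary. Only the values of `Bm` on `closure Ω`, of `Bp` on `Ωᶜ`, of `J` on `Ω`
and of `Bin` on `frontier Ω` matter. -/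
structure SolvesTransmission (Ω : Set E3) (J Bin Bm Bp : E3 → E3) : Prop where
  continuous_int : ContinuousOn Bm (closure Ω)
  continuous_ext : ContinuousOn Bp Ωᶜ
  eq_int : DivCurl Ω Bm J
  eq_ext : DivCurl (closure Ω)ᶜ Bp 0
  decay : DecaysAtInfinity Bp
  jump : ∀ x ∈ frontier Ω, Bm x - Bp x = Bin x

end

/-! A continuous field has no jump across `Γ`, so the equations `div B = 0` and `curl B = 0`, known
off `Γ`, hold on all of `ℝ³` as distributions. Then `curl curl = grad div - Δ` makes every component
weakly harmonic. Its mollifications are smooth, harmonic and tend to zero at infinity, so the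
maximum principle kills them, and they converge to the component. For the transmission problem, the
differences of two solutions agree on `Γ` and glue to a field of this kind.

Each curl component is, up to sign, the divergence of a field `rotField B i j`, so everything
reduces to scalar statements `WeakDivFree`. Classical solutions enter through a divergence theorem
that asks only for pointwise differentiability and an integrable divergence
(`integral_divergence_eq_zero`).

The crossing of `Γ` (`WeakDivFree.of_diff_levelSet`) uses no traces or surface measure. With a local
defining function `ρ`, a test function is cut off by `β (ρ / ε)`, and the error terms live in the
layer `|ρ| ≤ ε`, of measure `O(ε)`. The one carrying a factor `1 / ε` is handled by approximating
its continuous coefficient by a smooth one and integrating by parts in a direction transversal to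
`Γ` (`tendsto_integral_layer`). -/

/-- The vector field `Bᵢ eⱼ - Bⱼ eᵢ`, whose divergence is a component of the curl of `B`. -/
noncomputable def rotField (B : E3 → E3) (i j : Fin 3) (x : E3) : E3 :=
  B x i • EuclideanSpace.single j (1 : ℝ) - B x j • EuclideanSpace.single i (1 : ℝ)

/-- The vector field `F` is divergence-free in `U` in the sense of distributions. -/
def WeakDivFree (U : Set E3) (F : E3 → E3) : Prop :=
  ∀ φ : E3 → ℝ, IsTestOn U φ → ∫ x, fderiv ℝ φ x (F x) = 0

/-! ### Integration by parts for merely differentiable fields -/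

/-- On a box containing the support all face terms vanish. Only the divergence has to be integrable,
not the separate partial derivatives, which is why no `C¹` assumption is needed. -/
theorem integral_divergence_eq_zero {H : E3 → E3} (hc : HasCompactSupport H)
    (hd : Differentiable ℝ H) (hi : Integrable (divergence H)) : ∫ x, divergence H x = 0 := by
  obtain ⟨R, hR0, hR⟩ : ∃ R : ℝ, 0 < R ∧ tsupport H ⊆ Metric.ball 0 R :=
    hc.isBounded.subset_ball_lt 0 0
  set e := EuclideanSpace.equiv (Fin 3) ℝ with he
  have hmp : MeasurePreserving (e.symm : (Fin 3 → ℝ) → E3) := PiLp.volume_preserving_toLp (Fin 3)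
  have hout : ∀ y : Fin 3 → ℝ, (∃ i, R ≤ |y i|) → e.symm y ∉ tsupport H := by
    rintro y ⟨i, hy⟩ hmem
    have h1 := hR hmem
    rw [mem_ball_zero_iff] at h1
    have h2 : ‖(e.symm y) i‖ ≤ ‖e.symm y‖ := PiLp.norm_apply_le _ i
    have h3 : (e.symm y) i = y i := rfl
    rw [h3, Real.norm_eq_abs] at h2
    linarith
  let f : (Fin 3 → ℝ) → Fin 3 → ℝ := fun y => e (H (e.symm y))
  let f' : (Fin 3 → ℝ) → (Fin 3 → ℝ) →L[ℝ] Fin 3 → ℝ := fun y =>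
    (e : E3 →L[ℝ] (Fin 3 → ℝ)) ∘L fderiv ℝ H (e.symm y) ∘L (e.symm : (Fin 3 → ℝ) →L[ℝ] E3)
  have hf : ∀ y, HasFDerivAt f (f' y) y := fun y =>
    (e : E3 →L[ℝ] (Fin 3 → ℝ)).hasFDerivAt.comp y
      ((hd (e.symm y)).hasFDerivAt.comp y (e.symm : (Fin 3 → ℝ) →L[ℝ] E3).hasFDerivAt)
  have hdiv : (fun y => ∑ i, f' y (Pi.single i 1) i) = fun y => divergence H (e.symm y) := by
    funext y
    rfl
  have hint : Integrable (fun y => divergence H (e.symm y)) :=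
    (hmp.integrable_comp_emb (MeasurableEquiv.toLp 2 (Fin 3 → ℝ)).measurableEmbedding).2 hi
  have key := integral_divergence_of_hasFDerivAt_off_countable (n := 2) (fun _ => -R) (fun _ => R)
    (fun _ => by simp; linarith) f f' ∅ countable_empty
    (fun y _ => (hf y).continuousAt.continuousWithinAt) (fun y _ => hf y)
    (by rw [hdiv]; exact hint.integrableOn)
  have hface : ∀ (i : Fin 3) (c : ℝ) (z : Fin 2 → ℝ), |c| = R →
      f (i.insertNth (α := fun _ => ℝ) c z) i = 0 := by
    intro i c z hcR
    have : H (e.symm (i.insertNth (α := fun _ => ℝ) c z)) = 0 :=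
      image_eq_zero_of_notMem_tsupport (hout _ ⟨i, by simp [hcR]⟩)
    simp [f, this]
  simp only [hface _ R _ (abs_of_pos hR0), hface _ (-R) _ (by rw [abs_neg, abs_of_pos hR0]),
    integral_zero, sub_self, Finset.sum_const_zero] at key
  rw [hdiv, setIntegral_eq_integral_of_forall_compl_eq_zero] at key
  · rw [← key]
    exact (hmp.integral_comp (MeasurableEquiv.toLp 2 (Fin 3 → ℝ)).measurableEmbedding _).symm
  · intro y hy
    have hex : ∃ i, R < |y i| := by
      by_contra! h
      exact hy ⟨fun i => (abs_le.1 (h i)).1, fun i => (abs_le.1 (h i)).2⟩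
    obtain ⟨i, hy'⟩ := hex
    have hnot : e.symm y ∉ tsupport H := hout y ⟨i, hy'.le⟩
    have h0 : fderiv ℝ H (e.symm y) = 0 :=
      image_eq_zero_of_notMem_tsupport (fun h => hnot (tsupport_fderiv_subset ℝ h))
    simp [divergence, partialDeriv, h0]

theorem IsTestOn.continuous_fderiv_apply {U : Set E3} {φ : E3 → ℝ} (hφ : IsTestOn U φ)
    (hU : IsOpen U) {F : E3 → E3} (hF : ContinuousOn F U) :
    Continuous fun x => fderiv ℝ φ x (F x) := by
  have hs : tsupport (fun x => fderiv ℝ φ x (F x)) ⊆ tsupport φ :=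
    closure_minimal (fun x hx => tsupport_fderiv_subset ℝ (subset_tsupport _ (by
      intro h; apply hx; simp [h]))) (isClosed_tsupport φ)
  refine ContinuousOn.continuous_of_tsupport_subset ?_ hU (hs.trans hφ.support)
  exact (hφ.smooth.continuous_fderiv (by simp)).continuousOn.clm_apply hF

theorem IsTestOn.hasCompactSupport_fderiv_apply {U : Set E3} {φ : E3 → ℝ} (hφ : IsTestOn U φ)
    (F : E3 → E3) : HasCompactSupport fun x => fderiv ℝ φ x (F x) :=
  (hφ.compact.fderiv ℝ).mono fun x hx h => hx (by simp [h])

theorem IsTestOn.integrable_fderiv_apply {U : Set E3} {φ : E3 → ℝ} (hφ : IsTestOn U φ)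
    (hU : IsOpen U) {F : E3 → E3} (hF : ContinuousOn F U) :
    Integrable fun x => fderiv ℝ φ x (F x) :=
  (hφ.continuous_fderiv_apply hU hF).integrable_of_hasCompactSupport
    (hφ.hasCompactSupport_fderiv_apply F)

theorem IsTestOn.integrable_mul {U : Set E3} {φ g : E3 → ℝ} (hφ : IsTestOn U φ)
    (hg : LocallyIntegrableOn g U) : Integrable fun x => φ x * g x := by
  have h1 : IntegrableOn (fun x => φ x * g x) (tsupport φ) :=
    (hg.integrableOn_compact_subset hφ.support hφ.compact).continuousOn_mul
      hφ.smooth.continuous.continuousOn hφ.compact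
  refine (integrableOn_iff_integrable_of_support_subset ?_).1 h1
  exact fun x hx => subset_tsupport _ (fun h => hx (by simp [h]))

theorem divergence_smul {φ : E3 → ℝ} {F : E3 → E3} {x : E3} (hφ : DifferentiableAt ℝ φ x)
    (hF : DifferentiableAt ℝ F x) :
    divergence (fun y => φ y • F y) x = φ x * divergence F x + fderiv ℝ φ x (F x) := by
  have h1 : fderiv ℝ (fun y => φ y • F y) x =
      φ x • fderiv ℝ F x + (fderiv ℝ φ x).smulRight (F x) := fderiv_fun_smul hφ hF
  have h2 : fderiv ℝ φ x (F x) =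
      ∑ i, F x i * fderiv ℝ φ x (EuclideanSpace.single i 1) := by
    conv_lhs => rw [← (EuclideanSpace.basisFun (Fin 3) ℝ).sum_repr (F x)]
    simp [map_sum]
  simp only [divergence, partialDeriv, h1, h2, Finset.mul_sum]
  rw [← Finset.sum_add_distrib]
  refine Finset.sum_congr rfl fun i _ => ?_
  simp [mul_comm]

/-- A field that is differentiable at every point of an open set, with locally integrable
divergence, has this divergence in the sense of distributions too. -/
theorem integral_fderiv_apply_eq_of_divergence {U : Set E3} {F : E3 → E3} {g φ : E3 → ℝ}
    (hU : IsOpen U) (hF : ∀ x ∈ U, DifferentiableAt ℝ F x) (hdiv : ∀ x ∈ U, divergence F x = g x)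
    (hg : LocallyIntegrableOn g U) (hφ : IsTestOn U φ) :
    ∫ x, fderiv ℝ φ x (F x) = -∫ x, φ x * g x := by
  have hφd : Differentiable ℝ φ := hφ.smooth.differentiable (by simp)
  have hzero : ∀ x ∉ tsupport φ, (fun y => φ y • F y) =ᶠ[nhds x] fun _ => 0 := by
    intro x hx
    filter_upwards [(isClosed_tsupport φ).isOpen_compl.mem_nhds hx] with y hy
    simp [image_eq_zero_of_notMem_tsupport hy]
  have hD : Differentiable ℝ fun y => φ y • F y := by
    intro x
    by_cases hx : x ∈ tsupport φ
    · exact (hφd x).smul (hF x (hφ.support hx))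
    · exact (differentiableAt_const _).congr_of_eventuallyEq (hzero x hx)
  have hdivH : divergence (fun y => φ y • F y) =
      fun x => φ x * g x + fderiv ℝ φ x (F x) := by
    funext x
    by_cases hx : x ∈ tsupport φ
    · rw [divergence_smul (hφd x) (hF x (hφ.support hx)), hdiv x (hφ.support hx)]
    · have h0 : fderiv ℝ φ x = 0 :=
        image_eq_zero_of_notMem_tsupport (fun h => hx (tsupport_fderiv_subset ℝ h))
      simp [divergence, partialDeriv, (hzero x hx).fderiv_eq, h0,
        image_eq_zero_of_notMem_tsupport hx]
  have hcont : ContinuousOn F U := fun x hx => (hF x hx).continuousAt.continuousWithinAt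
  have hi1 := hφ.integrable_mul hg
  have hi2 := hφ.integrable_fderiv_apply hU hcont
  have h := integral_divergence_eq_zero (H := fun y => φ y • F y) hφ.compact.smul_right hD
    (by rw [hdivH]; exact hi1.add hi2)
  rw [hdivH, integral_add hi1 hi2] at h
  linarith

/-! ### Classical and weak equations in a common scalar form -/

theorem fderiv_apply_rotField (φ : E3 → ℝ) (B : E3 → E3) (i j : Fin 3) (x : E3) :
    fderiv ℝ φ x (rotField B i j x) = B x i * fderiv ℝ φ x (EuclideanSpace.single j 1) -
      B x j * fderiv ℝ φ x (EuclideanSpace.single i 1) := by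
  simp [rotField]

theorem continuousOn_rotField {U : Set E3} {B : E3 → E3} (hB : ContinuousOn B U) (i j : Fin 3) :
    ContinuousOn (rotField B i j) U := by
  unfold rotField
  fun_prop

theorem differentiableAt_rotField {B : E3 → E3} {x : E3} (hB : DifferentiableAt ℝ B x)
    (i j : Fin 3) : DifferentiableAt ℝ (rotField B i j) x := by
  unfold rotField
  fun_prop

theorem divergence_rotField {B : E3 → E3} {x : E3} (hB : DifferentiableAt ℝ B x)
    (i j : Fin 3) :
    divergence (rotField B i j) x = partialDeriv j B i x - partialDeriv i B j x := by
  have hc : ∀ k, HasFDerivAt (fun y => B y k)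
      ((EuclideanSpace.proj k : E3 →L[ℝ] ℝ) ∘L fderiv ℝ B x) x := fun k =>
    (EuclideanSpace.proj k : E3 →L[ℝ] ℝ).hasFDerivAt.comp x hB.hasFDerivAt
  have h := ((hc i).smul_const (EuclideanSpace.single j (1 : ℝ))).sub
    ((hc j).smul_const (EuclideanSpace.single i (1 : ℝ)))
  have h' : fderiv ℝ (rotField B i j) x = _ := h.fderiv
  simp only [divergence, partialDeriv, h']
  simp [Finset.sum_sub_distrib]

/-- The equations `∇ × B = J` and `∇ · B = 0` in `U`, tested against scalar functions. -/
structure ScalarDivCurl (U : Set E3) (B J : E3 → E3) : Prop where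
  div_eq : WeakDivFree U B
  curl_eq : ∀ (k : Fin 3) (φ : E3 → ℝ), IsTestOn U φ →
    ∫ x, fderiv ℝ φ x (rotField B (k + 1) (k + 2) x) = ∫ x, φ x * J x k

/-- Addition in `Fin 3` is modulo 3, so one formula covers the three cyclic components. -/
theorem curl_apply (B : E3 → E3) (x : E3) (k : Fin 3) :
    curl B x k = partialDeriv (k + 1) B (k + 2) x - partialDeriv (k + 2) B (k + 1) x := by
  fin_cases k <;> rfl

theorem ClassicalDivCurl.scalar {U : Set E3} {B J : E3 → E3} (h : ClassicalDivCurl U B J)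
    (hU : IsOpen U) (hJ : LocallyIntegrableOn J U) : ScalarDivCurl U B J where
  div_eq φ hφ := by
    rw [integral_fderiv_apply_eq_of_divergence hU h.differentiable (g := fun _ => 0) h.div_eq
      locallyIntegrableOn_zero hφ]
    simp
  curl_eq k φ hφ := by
    -- The divergence of `rotField B (k + 1) (k + 2)` is minus the `k`-th curl component; this sign
    -- cancels the one from integration by parts.
    have hJk : LocallyIntegrableOn (fun x => -J x k) U := fun x hx => by
      obtain ⟨s, hs, hi⟩ := hJ x hx
      exact ⟨s, hs, ((EuclideanSpace.proj k : E3 →L[ℝ] ℝ).integrable_comp hi).neg⟩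
    rw [integral_fderiv_apply_eq_of_divergence hU
      (fun x hx => differentiableAt_rotField (h.differentiable x hx) _ _) ?_ hJk hφ]
    · simp [integral_neg]
    · intro x hx
      rw [divergence_rotField (h.differentiable x hx), ← h.curl_eq x hx, curl_apply]
      ring

theorem IsTestOn.smul_single {U : Set E3} {φ : E3 → ℝ} (hφ : IsTestOn U φ) (k : Fin 3) :
    IsTestOn U fun x => φ x • (EuclideanSpace.single k 1 : E3) where
  smooth := hφ.smooth.smul contDiff_const
  compact := hφ.compact.smul_right
  support := (closure_mono (Function.support_smul_subset_left φ _)).trans hφ.support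

/-- Testing the weak curl equation with `φ e_k` isolates its `k`-th component. -/
theorem inner_curl_smul_single {φ : E3 → ℝ} {x : E3} (hφ : DifferentiableAt ℝ φ x) (B : E3 → E3)
    (k : Fin 3) : inner ℝ (B x) (curl (fun y => φ y • (EuclideanSpace.single k 1 : E3)) x) =
      fderiv ℝ φ x (rotField B (k + 1) (k + 2) x) := by
  have h1 : ∀ i j, partialDeriv j (fun y => φ y • (EuclideanSpace.single k 1 : E3)) i x =
      fderiv ℝ φ x (EuclideanSpace.single j 1) * (EuclideanSpace.single k 1 : E3) i := by
    intro i j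
    have := (hφ.hasFDerivAt.smul_const (EuclideanSpace.single k 1 : E3)).fderiv
    rw [partialDeriv, this]
    simp
  rw [fderiv_apply_rotField, PiLp.inner_apply]
  simp only [Fin.sum_univ_three, curl_apply, h1]
  fin_cases k <;> simp <;> ring

theorem WeakDivCurl.scalar {U : Set E3} {B J : E3 → E3} (h : WeakDivCurl U B J) :
    ScalarDivCurl U B J where
  div_eq φ hφ := by
    rw [← h.div_eq φ hφ]
    congr 1
    funext x
    rw [real_inner_comm, gradient, InnerProductSpace.toDual_symm_apply]
  curl_eq k φ hφ := by
    have := h.curl_eq _ (hφ.smul_single k)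
    simp only [inner_curl_smul_single (hφ.smooth.differentiable (by simp) _)] at this
    rw [this]
    congr 1
    funext x
    simp [inner_smul_right, EuclideanSpace.inner_single_right]

theorem WeakDivFree.sub {U : Set E3} {F G : E3 → E3} (hU : IsOpen U) (hF : ContinuousOn F U)
    (hG : ContinuousOn G U)
    (h : ∀ φ : E3 → ℝ, IsTestOn U φ → ∫ x, fderiv ℝ φ x (F x) = ∫ x, fderiv ℝ φ x (G x)) :
    WeakDivFree U fun x => F x - G x := by
  intro φ hφ
  simp only [map_sub]
  rw [integral_sub (hφ.integrable_fderiv_apply hU hF) (hφ.integrable_fderiv_apply hU hG), h φ hφ,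
    sub_self]

theorem rotField_sub (B C : E3 → E3) (i j : Fin 3) :
    rotField (fun x => B x - C x) i j = fun x => rotField B i j x - rotField C i j x := by
  funext x
  simp only [rotField, PiLp.sub_apply, sub_smul]
  abel

theorem ScalarDivCurl.sub {U : Set E3} {B C J : E3 → E3} (hU : IsOpen U) (hB : ContinuousOn B U)
    (hC : ContinuousOn C U) (h₁ : ScalarDivCurl U B J) (h₂ : ScalarDivCurl U C J) :
    ScalarDivCurl U (fun x => B x - C x) 0 where
  div_eq := .sub hU hB hC fun φ hφ => (h₁.div_eq φ hφ).trans (h₂.div_eq φ hφ).symm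
  curl_eq k φ hφ := by
    rw [rotField_sub]
    simpa using WeakDivFree.sub hU (continuousOn_rotField hB _ _) (continuousOn_rotField hC _ _)
      (fun φ hφ => (h₁.curl_eq k φ hφ).trans (h₂.curl_eq k φ hφ).symm) φ hφ

/-- For two classical solutions `J` need not be locally integrable, so they are subtracted
pointwise, before passing to the weak form. -/
theorem ClassicalDivCurl.sub {U : Set E3} {B C J : E3 → E3}
    (h₁ : ClassicalDivCurl U B J) (h₂ : ClassicalDivCurl U C J) :
    ClassicalDivCurl U (fun x => B x - C x) 0 := by
  have hp : ∀ x ∈ U, ∀ i j, partialDeriv j (fun x => B x - C x) i x =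
      partialDeriv j B i x - partialDeriv j C i x := by
    intro x hx i j
    simp [partialDeriv, fderiv_fun_sub (h₁.differentiable x hx) (h₂.differentiable x hx)]
  refine ⟨fun x hx => (h₁.differentiable x hx).sub (h₂.differentiable x hx), fun x hx => ?_,
    fun x hx => ?_⟩
  · ext k
    have e1 := congrArg (fun v : E3 => v k) (h₁.curl_eq x hx)
    have e2 := congrArg (fun v : E3 => v k) (h₂.curl_eq x hx)
    simp only [curl_apply] at e1 e2
    simp only [curl_apply, hp x hx, Pi.zero_apply, PiLp.zero_apply]
    linarith
  · have e1 := h₁.div_eq x hx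
    have e2 := h₂.div_eq x hx
    simp only [divergence] at e1 e2
    simp only [divergence, hp x hx, Finset.sum_sub_distrib, e1, e2, sub_self]

/-- In the mixed cases the weak solution supplies the local integrability of `J` that the classical
one needs. -/
theorem DivCurl.scalar_sub {U : Set E3} {B C J : E3 → E3} (hU : IsOpen U) (hB : ContinuousOn B U)
    (hC : ContinuousOn C U) (h₁ : DivCurl U B J) (h₂ : DivCurl U C J) :
    ScalarDivCurl U (fun x => B x - C x) 0 := by
  rcases h₁ with h₁ | h₁ <;> rcases h₂ with h₂ | h₂
  · exact (h₁.sub h₂).scalar hU locallyIntegrableOn_zero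
  · exact .sub hU hB hC (h₁.scalar hU h₂.locallyIntegrable_curl) h₂.scalar
  · exact .sub hU hB hC h₁.scalar (h₂.scalar hU h₁.locallyIntegrable_curl)
  · exact .sub hU hB hC h₁.scalar h₂.scalar

/-! ### The maximum principle -/

/-- If `c > 0`, the second derivative test makes `t₀` a local minimum as well, so `g` is locally
constant and its second derivative is zero. -/
theorem IsLocalMax.second_deriv_nonpos {g g₁ : ℝ → ℝ} {c t₀ : ℝ} (hg : IsLocalMax g t₀)
    (h₁ : ∀ t, HasDerivAt g (g₁ t) t) (h₂ : HasDerivAt g₁ c t₀) : c ≤ 0 := by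
  by_contra! hc
  have hd : deriv g = g₁ := funext fun t => (h₁ t).deriv
  have hmin : IsLocalMin g t₀ := isLocalMin_of_deriv_deriv_pos (by rwa [hd, h₂.deriv])
    hg.deriv_eq_zero (h₁ t₀).continuousAt
  have hconst : g =ᶠ[nhds t₀] fun _ => g t₀ := by
    filter_upwards [hg, hmin] with t h h' using le_antisymm h h'
  have hd0 : deriv (deriv g) t₀ = 0 := by
    rw [hconst.deriv.deriv_eq]
    simp
  rw [hd, h₂.deriv] at hd0
  exact hc.ne' hd0

/-- Maximum principle: a harmonic function on `ℝ³` that vanishes at infinity is nonpositive. -/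
theorem harmonic_nonpos_of_tendsto_zero {w : E3 → ℝ} (hw : ContDiff ℝ 2 w)
    (h0 : Filter.Tendsto w (Bornology.cobounded E3) (nhds 0))
    (hΔ : ∀ x, ∑ j : Fin 3, fderiv ℝ (fun y => fderiv ℝ w y (EuclideanSpace.single j 1)) x
      (EuclideanSpace.single j 1) = 0) (a : E3) : w a ≤ 0 := by
  by_contra! ha
  obtain ⟨R, hR0, hR⟩ : ∃ R : ℝ, 0 < R ∧ ∀ x, R ≤ ‖x - a‖ → w x < w a / 2 := by
    have hev := h0.eventually (gt_mem_nhds (half_pos ha))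
    rw [(Metric.hasBasis_cobounded_compl_ball a).eventually_iff] at hev
    obtain ⟨R, -, hR⟩ := hev
    refine ⟨max R 1, by positivity, fun x hx => hR ?_⟩
    simp only [mem_compl_iff, Metric.mem_ball, not_lt, dist_eq_norm]
    exact (le_max_left _ _).trans hx
  -- The perturbation `ε ‖x - a‖ ^ 2` equals `w a / 2` at radius `R`, where `w < w a / 2`. Hence `v
  -- < w a` on the sphere, and the maximum of `v` over the ball is interior, although the Laplacian
  -- of `v` is `6 ε > 0`.
  set ε := w a / (2 * R ^ 2) with hε
  have hε0 : 0 < ε := by positivity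
  let v : E3 → ℝ := fun x => w x + ε * ‖x - a‖ ^ 2
  have hvc : Continuous v := by have := hw.continuous; fun_prop
  obtain ⟨p, hp, hmax⟩ := (isCompact_closedBall a R).exists_isMaxOn
    (Metric.nonempty_closedBall.2 hR0.le) hvc.continuousOn
  have hva : w a ≤ v p := by
    have : v a ≤ v p := hmax (Metric.mem_closedBall_self hR0.le)
    simpa [v] using this
  have hpR : ‖p - a‖ < R := by
    refine lt_of_le_of_ne (by simpa [dist_eq_norm] using hp) fun h => ?_
    have h1 := hR p h.ge
    have h2 : ε * R ^ 2 = w a / 2 := by rw [hε]; field_simp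
    simp only [v, h] at hva
    linarith
  have hloc : IsLocalMax v p := hmax.isLocalMax
    (Filter.mem_of_superset (Metric.isOpen_ball.mem_nhds (by simpa [dist_eq_norm] using hpR))
      Metric.ball_subset_closedBall)
  have hj : ∀ j : Fin 3, fderiv ℝ (fun y => fderiv ℝ w y (EuclideanSpace.single j 1)) p
      (EuclideanSpace.single j 1) + 2 * ε ≤ 0 := by
    intro j
    set e : E3 := EuclideanSpace.single j 1 with he
    have hne : ‖e‖ = 1 := by simp [he]
    have hline : ∀ t : ℝ, HasDerivAt (fun t : ℝ => p + t • e) e t := fun t => by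
      simpa using ((hasDerivAt_id t).smul_const e).const_add p
    have hq : ∀ t : ℝ, ‖p + t • e - a‖ ^ 2 = ‖p - a‖ ^ 2 + 2 * t * inner ℝ (p - a) e + t ^ 2 := by
      intro t
      rw [show p + t • e - a = (p - a) + t • e by abel, norm_add_sq_real, inner_smul_right,
        norm_smul, hne]
      simp
      ring
    refine IsLocalMax.second_deriv_nonpos (g := fun t => v (p + t • e))
      (g₁ := fun t => fderiv ℝ w (p + t • e) e + ε * (2 * inner ℝ (p - a) e + 2 * t)) (t₀ := 0)
      ?_ (fun t => ?_) ?_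
    · have hcont : ContinuousAt (fun t : ℝ => p + t • e) 0 := (hline 0).continuousAt
      have : IsLocalMax v (p + (0 : ℝ) • e) := by rwa [zero_smul, add_zero]
      exact IsLocalMax.comp_continuous (g := fun t : ℝ => p + t • e) this hcont
    · have hwt := ((hw.differentiable (by norm_num)) (p + t • e)).hasFDerivAt.comp_hasDerivAt t
        (hline t)
      simp only [v, hq]
      refine hwt.add (HasDerivAt.const_mul ε ?_)
      have := (((hasDerivAt_id t).const_mul 2).mul_const (inner ℝ (p - a) e)).const_add
        (‖p - a‖ ^ 2) |>.add ((hasDerivAt_id t).pow 2)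
      refine this.congr_deriv ?_
      simp
    · have hd : DifferentiableAt ℝ (fun y => fderiv ℝ w y e) (p + (0 : ℝ) • e) :=
        ((hw.fderiv_right (m := 1) (by norm_num)).clm_apply contDiff_const).differentiable
          (by norm_num) _
      have h1 := hd.hasFDerivAt.comp_hasDerivAt (0 : ℝ) (hline 0)
      have h2 : HasDerivAt (fun t : ℝ => ε * (2 * inner ℝ (p - a) e + 2 * t)) (2 * ε) 0 := by
        have := (((hasDerivAt_id (0 : ℝ)).const_mul 2).const_add
          (2 * inner ℝ (p - a) e)).const_mul ε
        exact this.congr_deriv (by ring)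
      have h3 := h1.add h2
      rw [zero_smul, add_zero] at h3
      exact h3
  have := hΔ p
  have h0 := hj 0
  have h1 := hj 1
  have h2 := hj 2
  rw [Fin.sum_univ_three] at this
  linarith

/-! ### Weak harmonicity and the Liouville argument by mollification -/

theorem IsTestOn.fderiv_apply {φ : E3 → ℝ} (hφ : IsTestOn univ φ) (v : E3) :
    IsTestOn univ fun x => fderiv ℝ φ x v where
  smooth := (hφ.smooth.fderiv_right (m := ∞) (by simp)).clm_apply contDiff_const
  compact := hφ.hasCompactSupport_fderiv_apply fun _ => v
  support := subset_univ _

theorem fderiv_fderiv_apply_comm {φ : E3 → ℝ} (hφ : ContDiff ℝ ∞ φ) (x v w : E3) :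
    fderiv ℝ (fun y => fderiv ℝ φ y v) x w = fderiv ℝ (fun y => fderiv ℝ φ y w) x v := by
  have hd : DifferentiableAt ℝ (fderiv ℝ φ) x :=
    (hφ.fderiv_right (m := 1) (by norm_cast)).differentiable (by norm_num) x
  have h := second_derivative_symmetric (f := φ) (f' := fderiv ℝ φ)
    (fun y => (hφ.differentiable (by simp) y).hasFDerivAt) hd.hasFDerivAt w v
  have key : ∀ u : E3, fderiv ℝ (fun y => fderiv ℝ φ y u) x = (fderiv ℝ (fderiv ℝ φ) x).flip u :=
    fun u => (hd.hasFDerivAt.clm_apply (hasFDerivAt_const u x)).fderiv.trans (by ext; simp)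
  rw [key, key]
  exact h

/-- The components of a divergence-free and curl-free field are weakly harmonic. -/
theorem ScalarDivCurl.weakly_harmonic {b : E3 → E3} (hb : Continuous b)
    (h : ScalarDivCurl univ b 0) {φ : E3 → ℝ} (hφ : IsTestOn univ φ) (i : Fin 3) :
    ∫ x, (∑ j : Fin 3, fderiv ℝ (fun y => fderiv ℝ φ y (EuclideanSpace.single j 1)) x
      (EuclideanSpace.single j 1)) * b x i = 0 := by
  -- The curl equation gives the three cyclic index pairs; antisymmetry and the trivial diagonal
  -- give the rest.
  have hrot : ∀ j : Fin 3, WeakDivFree univ (rotField b i j) := by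
    have hswap : ∀ p q : Fin 3, WeakDivFree univ (rotField b p q) →
        WeakDivFree univ (rotField b q p) := by
      intro p q hpq ψ hψ
      rw [← neg_eq_zero, ← integral_neg, ← hpq ψ hψ]
      congr 1
      funext x
      simp only [fderiv_apply_rotField]
      ring
    have hk : ∀ k : Fin 3, WeakDivFree univ (rotField b (k + 1) (k + 2)) := fun k ψ hψ => by
      simpa using h.curl_eq k ψ hψ
    have hdiag : ∀ p : Fin 3, WeakDivFree univ (rotField b p p) := fun p ψ _ => by
      simp [rotField]
    intro j
    have e0 : WeakDivFree univ (rotField b 1 2) := hk 0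
    have e1 : WeakDivFree univ (rotField b 2 0) := hk 1
    have e2 : WeakDivFree univ (rotField b 0 1) := hk 2
    fin_cases i <;> fin_cases j <;>
      first | exact hdiag _ | assumption | exact hswap _ _ (by assumption)
  set e : Fin 3 → E3 := fun j => EuclideanSpace.single j 1 with he
  have hbase : ∀ x, b x = ∑ j, b x j • e j := fun x => by
    conv_lhs => rw [← (EuclideanSpace.basisFun (Fin 3) ℝ).sum_repr (b x)]
    simp [he]
  have hint : ∀ j, Integrable fun x => fderiv ℝ (fun y => fderiv ℝ φ y (e j)) x
      (rotField b i j x) := fun j =>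
    (hφ.fderiv_apply (e j)).integrable_fderiv_apply isOpen_univ
      (continuousOn_rotField hb.continuousOn i j)
  have hint' : Integrable fun x => fderiv ℝ (fun y => fderiv ℝ φ y (e i)) x (b x) :=
    (hφ.fderiv_apply (e i)).integrable_fderiv_apply isOpen_univ hb.continuousOn
  -- This is `curl curl = grad div - Δ` in tested form: the first term is `b_i ∂_j ∂_j φ - b_j ∂_i
  -- ∂_j φ` summed over `j`, and the mixed derivatives cancel against `∇(∂_i φ) · b`.
  have key : ∀ x, (∑ j : Fin 3, fderiv ℝ (fun y => fderiv ℝ φ y (e j)) x (e j)) * b x i =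
      (∑ j, fderiv ℝ (fun y => fderiv ℝ φ y (e j)) x (rotField b i j x)) +
        fderiv ℝ (fun y => fderiv ℝ φ y (e i)) x (b x) := by
    intro x
    have e1 : fderiv ℝ (fun y => fderiv ℝ φ y (e i)) x (b x) =
        ∑ j, b x j * fderiv ℝ (fun y => fderiv ℝ φ y (e j)) x (e i) := by
      conv_lhs => rw [hbase x]
      simp only [map_sum, map_smul, smul_eq_mul]
      exact Finset.sum_congr rfl fun j _ => by rw [fderiv_fderiv_apply_comm hφ.smooth]
    rw [e1, ← Finset.sum_add_distrib, Finset.sum_mul]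
    refine Finset.sum_congr rfl fun j _ => ?_
    rw [fderiv_apply_rotField]
    simp only [he]
    ring
  refine (integral_congr_ae (Filter.Eventually.of_forall key)).trans ?_
  rw [integral_add (integrable_finsetSum _ fun j _ => hint j) hint',
    integral_finsetSum _ fun j _ => hint j, h.div_eq _ (hφ.fderiv_apply (e i))]
  simp [hrot _ _ (hφ.fderiv_apply (e _))]

theorem fderiv_convolution_apply {k u : E3 → ℝ} (hk : IsTestOn univ k) (hu : Continuous u)
    (x v : E3) :
    fderiv ℝ (convolution k u (ContinuousLinearMap.lsmul ℝ ℝ) volume) x v =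
      convolution (fun y => fderiv ℝ k y v) u (ContinuousLinearMap.lsmul ℝ ℝ) volume x := by
  rw [(hk.compact.hasFDerivAt_convolution_left (ContinuousLinearMap.lsmul ℝ ℝ)
    (hk.smooth.of_le (by norm_cast)) hu.locallyIntegrable x).fderiv]
  have hex : ConvolutionExistsAt (fderiv ℝ k) u x
      ((ContinuousLinearMap.lsmul ℝ ℝ).precompL E3) volume :=
    (hk.compact.fderiv ℝ).convolutionExists_left _ (hk.smooth.continuous_fderiv (by simp))
      hu.locallyIntegrable x
  rw [convolution, convolution, ContinuousLinearMap.integral_apply hex]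
  rfl

/-- A continuous, weakly divergence-free and curl-free field on `ℝ³` that tends to zero at infinity
vanishes. -/
theorem ScalarDivCurl.eq_zero {b : E3 → E3} (hb : Continuous b) (h : ScalarDivCurl univ b 0)
    (h0 : Filter.Tendsto b (Bornology.cobounded E3) (nhds 0)) (x : E3) : b x = 0 := by
  ext i
  have hu : Continuous fun y => b y i := by fun_prop
  have hu0 : Filter.Tendsto (fun y => b y i) (Bornology.cobounded E3) (nhds 0) := by
    exact ((EuclideanSpace.proj i : E3 →L[ℝ] ℝ).continuous.tendsto' 0 0 (map_zero _)).comp h0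
  have hzero : ∀ f : ContDiffBump (0 : E3), convolution (f.normed volume) (fun y => b y i)
      (ContinuousLinearMap.lsmul ℝ ℝ) volume x = 0 := by
    intro f
    have hk : IsTestOn univ (f.normed volume) :=
      ⟨f.contDiff_normed, f.hasCompactSupport_normed, subset_univ _⟩
    set w := convolution (f.normed volume) (fun y => b y i) (ContinuousLinearMap.lsmul ℝ ℝ) volume
      with hw
    have hwC : ContDiff ℝ 2 w := hk.compact.contDiff_convolution_left _
      (hk.smooth.of_le (by norm_cast)) hu.locallyIntegrable
    have hw0 : Filter.Tendsto w (Bornology.cobounded E3) (nhds 0) := by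
      rw [Metric.tendsto_nhds]
      intro ε hε
      -- Beyond radius `R + rOut` every value averaged by the mollifier is below `ε / 3`, so `w y`
      -- differs from `b y i` by at most `2 ε / 3`, and `b y i` itself is below `ε / 3`.
      have hev := Metric.tendsto_nhds.1 hu0 (ε / 3) (by positivity)
      rw [(Metric.hasBasis_cobounded_compl_ball (0 : E3)).eventually_iff] at hev ⊢
      obtain ⟨R, -, hR⟩ := hev
      refine ⟨R + f.rOut, trivial, fun y hy => ?_⟩
      simp only [mem_compl_iff, Metric.mem_ball, not_lt, dist_zero_right] at hR hy ⊢
      have hy' := hR (x := y) (by linarith [f.rOut_pos])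
      have hd : dist (w y) (b y i) ≤ 2 * ε / 3 := by
        refine f.dist_normed_convolution_le hu.aestronglyMeasurable fun z hz => ?_
        have h1 := norm_sub_norm_le y z
        rw [Metric.mem_ball, dist_comm, dist_eq_norm] at hz
        have h2 := hR (x := z) (by linarith)
        rw [Real.dist_eq]
        rw [Real.norm_eq_abs] at h2 hy'
        have h3 := abs_sub (b z i) (b y i)
        linarith
      rw [Real.dist_eq] at hd
      rw [Real.norm_eq_abs] at hy' ⊢
      have := abs_sub_abs_le_abs_sub (w y) (b y i)
      linarith
    have hΔ : ∀ y, ∑ j : Fin 3, fderiv ℝ (fun y => fderiv ℝ w y (EuclideanSpace.single j 1)) y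
        (EuclideanSpace.single j 1) = 0 := by
      intro y
      -- The Laplacian of `w` at `y` is the weak equation tested with the reflected kernel; the two
      -- signs from the reflection cancel in second derivatives.
      have hφ : IsTestOn univ fun z => f.normed volume (y - z) := by
        refine ⟨hk.smooth.comp (contDiff_const.sub contDiff_id), ?_, subset_univ _⟩
        exact hk.compact.comp_homeomorph (Homeomorph.subLeft y)
      have hharm := h.weakly_harmonic hb hφ i
      have hrefl : ∀ (g : E3 → ℝ) (v : E3), Differentiable ℝ g → ∀ z,
          fderiv ℝ (fun z => g (y - z)) z v = -fderiv ℝ g (y - z) v := by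
        intro g v hg z
        have := ((hg (y - z)).hasFDerivAt.comp z ((hasFDerivAt_id z).const_sub y)).fderiv
        have h2 : fderiv ℝ (fun z => g (y - z)) z = _ := this
        rw [h2]
        simp
      have hdd : ∀ (j : Fin 3) (z : E3), fderiv ℝ (fun z' => fderiv ℝ (fun z =>
          f.normed volume (y - z)) z' (EuclideanSpace.single j 1)) z (EuclideanSpace.single j 1) =
          fderiv ℝ (fun z => fderiv ℝ (f.normed volume) z (EuclideanSpace.single j 1)) (y - z)
            (EuclideanSpace.single j 1) := by
        intro j z
        simp only [hrefl _ _ (hk.smooth.differentiable (by simp))]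
        rw [fderiv_fun_neg, neg_apply, hrefl (fun z => fderiv ℝ
          (f.normed volume) z (EuclideanSpace.single j 1)) _
          ((hk.fderiv_apply _).smooth.differentiable (by simp)), neg_neg]
      simp only [hdd] at hharm
      have hconv : ∀ j : Fin 3, fderiv ℝ (fun y => fderiv ℝ w y (EuclideanSpace.single j 1)) y
          (EuclideanSpace.single j 1) = ∫ z, fderiv ℝ (fun z => fderiv ℝ (f.normed volume) z
            (EuclideanSpace.single j 1)) (y - z) (EuclideanSpace.single j 1) * b z i := by
        intro j
        simp only [hw, fderiv_convolution_apply hk hu]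
        have e : (fun y => convolution (fun z => fderiv ℝ (f.normed volume) z
            (EuclideanSpace.single j 1)) (fun y => b y i) (ContinuousLinearMap.lsmul ℝ ℝ) volume y)
            = convolution (fun z => fderiv ℝ (f.normed volume) z (EuclideanSpace.single j 1))
              (fun y => b y i) (ContinuousLinearMap.lsmul ℝ ℝ) volume := rfl
        rw [e, fderiv_convolution_apply (hk.fderiv_apply _) hu, convolution_eq_swap]
        simp
      simp only [hconv]
      rw [← hharm, ← integral_finsetSum]
      · simp only [Finset.sum_mul]
      · intro j _
        have ht := (hk.fderiv_apply (EuclideanSpace.single j 1)).fderiv_apply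
          (EuclideanSpace.single j 1)
        refine Continuous.integrable_of_hasCompactSupport ?_ ?_
        · exact (ht.smooth.continuous.comp (continuous_const.sub continuous_id)).mul hu
        · exact (ht.compact.comp_homeomorph (Homeomorph.subLeft y)).mul_right
    refine le_antisymm (harmonic_nonpos_of_tendsto_zero hwC hw0 hΔ x) ?_
    have hneg := harmonic_nonpos_of_tendsto_zero (w := fun y => -w y) hwC.neg
      (by simpa using hw0.neg) (fun y => by simpa [fderiv_fun_neg, Finset.sum_neg_distrib] using hΔ y) x
    linarith
  have ht : Filter.Tendsto (fun n : ℕ => 1 / ((n : ℝ) + 1) + 1 / ((n : ℝ) + 1))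
      Filter.atTop (nhds 0) := by
    simpa using tendsto_one_div_add_atTop_nhds_zero_nat.add
      (tendsto_one_div_add_atTop_nhds_zero_nat (𝕜 := ℝ))
  -- Only the outer radius has to tend to zero; the inner one is half of it to meet the strict
  -- inequality between them.
  let F : ℕ → ContDiffBump (0 : E3) := fun n =>
    ⟨1 / ((n : ℝ) + 1), 1 / ((n : ℝ) + 1) + 1 / ((n : ℝ) + 1), by positivity,
      lt_add_of_pos_right _ (by positivity)⟩
  have hlim := ContDiffBump.convolution_tendsto_right_of_continuous (μ := volume) (φ := F) ht hu x
  simp only [hzero] at hlim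
  exact (tendsto_nhds_unique hlim tendsto_const_nhds)

/-! ### Cutoffs and localisation of test functions -/

theorem contDiff_of_contDiffAt_tsupport {f : E3 → ℝ} (h : ∀ x ∈ tsupport f, ContDiffAt ℝ ∞ f x) :
    ContDiff ℝ ∞ f := by
  refine contDiff_iff_contDiffAt.2 fun x => ?_
  by_cases hx : x ∈ tsupport f
  · exact h x hx
  · refine (contDiffAt_const (c := (0 : ℝ))).congr_of_eventuallyEq ?_
    filter_upwards [(isClosed_tsupport f).isOpen_compl.mem_nhds hx] with y hy
    exact image_eq_zero_of_notMem_tsupport hy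

theorem exists_isTestOn_eqOn_one {U K : Set E3} (hU : IsOpen U) (hK : IsCompact K) (hKU : K ⊆ U) :
    ∃ χ : E3 → ℝ, IsTestOn U χ ∧ EqOn χ 1 K ∧ ∀ x, 0 ≤ χ x := by
  obtain ⟨K', hK', hKK', hK'U⟩ := exists_compact_between hK hU hKU
  obtain ⟨f, hf0, hf1, hf⟩ := exists_contMDiffMap_zero_one_of_isClosed (n := ⊤)
    (modelWithCornersSelf ℝ E3) (isOpen_interior (s := K')).isClosed_compl hK.isClosed
    (disjoint_compl_left_iff_subset.2 hKK')
  have hts : tsupport f ⊆ K' := closure_minimal (fun x hx => by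
    by_contra hx'
    exact hx (hf0 fun h => hx' (interior_subset h))) hK'.isClosed
  exact ⟨f, ⟨f.contMDiff.contDiff, hK'.of_isClosed_subset (isClosed_tsupport _) hts,
    hts.trans hK'U⟩, hf1, fun x => (hf x).1⟩

/-- Asking only that the intersection of the supports lie in `V` lets either factor, or both
together, provide the localisation. -/
theorem IsTestOn.mul_left {U V : Set E3} {φ : E3 → ℝ} (hφ : IsTestOn U φ) {f : E3 → ℝ}
    (hf : ContDiff ℝ ∞ f) (hV : tsupport f ∩ tsupport φ ⊆ V) : IsTestOn V fun x => f x * φ x where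
  smooth := hf.mul hφ.smooth
  compact := hφ.compact.mul_left
  support := (subset_inter (tsupport_mul_subset_left (f := f) (g := φ))
    (tsupport_mul_subset_right (f := f) (g := φ))).trans hV

/-- Being weakly divergence-free is a local property. -/
theorem WeakDivFree.of_locally {O : Set E3} {F : E3 → E3} (hO : IsOpen O) (hF : ContinuousOn F O)
    (h : ∀ x ∈ O, ∃ N, IsOpen N ∧ x ∈ N ∧ WeakDivFree N F) : WeakDivFree O F := by
  intro φ hφ
  have h' : ∀ x : tsupport φ, ∃ N, IsOpen N ∧ (x : E3) ∈ N ∧ WeakDivFree N F := fun x =>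
    h x (hφ.support x.2)
  choose N hNo hxN hN using h'
  obtain ⟨f, hf⟩ := SmoothPartitionOfUnity.exists_isSubordinate (modelWithCornersSelf ℝ E3)
    (isClosed_tsupport φ) N hNo (fun x hx => mem_iUnion.2 ⟨⟨x, hx⟩, hxN ⟨x, hx⟩⟩)
  -- Compactness leaves finitely many members of the partition of unity on the support of `φ`, so
  -- the sum passes through derivative and integral.
  have hfin := f.locallyFinite.finite_nonempty_inter_compact hφ.compact
  set T := hfin.toFinset with hT
  have hsum : φ = fun x => ∑ i ∈ T, f i x * φ x := by
    funext x
    by_cases hx : x ∈ tsupport φ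
    · rw [← Finset.sum_mul]
      have h1 : ∑ᶠ i, f i x = ∑ i ∈ T, f i x := finsum_eq_sum_of_support_subset _ (by
        intro i hi
        rw [hT, Finite.coe_toFinset]
        exact ⟨x, hi, hx⟩)
      rw [← h1, f.sum_eq_one hx, one_mul]
    · simp [image_eq_zero_of_notMem_tsupport hx]
  have hsm : ∀ i, ContDiff ℝ ∞ (f i) := fun i => (f i).contMDiff.contDiff
  have ht : ∀ i, IsTestOn (N i) fun x => f i x * φ x := fun i =>
    hφ.mul_left (hsm i) (inter_subset_left.trans (hf i))
  have ht' : ∀ i, IsTestOn O fun x => f i x * φ x := fun i =>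
    hφ.mul_left (hsm i) (inter_subset_right.trans hφ.support)
  have hd : ∀ x, fderiv ℝ φ x (F x) = ∑ i ∈ T, fderiv ℝ (fun x => f i x * φ x) x (F x) := by
    intro x
    conv_lhs => rw [hsum]
    rw [fderiv_fun_sum fun i _ => (ht i).smooth.differentiable (by simp) x]
    simp
  simp only [hd]
  rw [integral_finsetSum _ fun i _ => (ht' i).integrable_fderiv_apply hO hF]
  exact Finset.sum_eq_zero fun i _ => hN i _ (ht i)

/-! ### Integrals over thin layers around a level set -/

theorem IsTestOn.div {U : Set E3} {φ q : E3 → ℝ} (hφ : IsTestOn U φ) (hq : ContDiff ℝ ∞ q)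
    (hU : ∀ x ∈ U, q x ≠ 0) : IsTestOn U fun x => φ x / q x := by
  have hs : tsupport (fun x => φ x / q x) ⊆ tsupport φ :=
    closure_mono fun x hx h => hx (by simp [h])
  refine ⟨contDiff_of_contDiffAt_tsupport fun x hx => ?_,
    hφ.compact.of_isClosed_subset (isClosed_tsupport _) hs, hs.trans hφ.support⟩
  exact hφ.smooth.contDiffAt.div hq.contDiffAt (hU x (hφ.support (hs hx)))

theorem IsTestOn.integral_mul_fderiv {U : Set E3} {g h : E3 → ℝ} (hg : IsTestOn U g)
    (hh : ContDiff ℝ ∞ h) (e : E3) :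
    ∫ x, g x * fderiv ℝ h x e = -∫ x, fderiv ℝ g x e * h x := by
  have hg1 : Continuous fun x => fderiv ℝ g x e :=
    (hg.smooth.continuous_fderiv (by simp)).clm_apply continuous_const
  have hh1 : Continuous fun x => fderiv ℝ h x e :=
    (hh.continuous_fderiv (by simp)).clm_apply continuous_const
  refine integral_mul_fderiv_eq_neg_fderiv_mul_of_integrable ?_ ?_ ?_
    (fun x _ => hg.smooth.differentiable (by simp) x) (fun x _ => hh.differentiable (by simp) x)
  · exact (hg1.mul hh.continuous).integrable_of_hasCompactSupport
      (hg.hasCompactSupport_fderiv_apply fun _ => e).mul_right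
  · exact (hg.smooth.continuous.mul hh1).integrable_of_hasCompactSupport hg.compact.mul_right
  · exact (hg.smooth.continuous.mul hh.continuous).integrable_of_hasCompactSupport
      hg.compact.mul_right

theorem fderiv_comp_div_apply {ρ : E3 → ℝ} {f : ℝ → ℝ} (hρ : Differentiable ℝ ρ)
    (hf : Differentiable ℝ f) (ε : ℝ) (x v : E3) :
    fderiv ℝ (fun y => f (ρ y / ε)) x v = deriv f (ρ x / ε) * (fderiv ℝ ρ x v / ε) := by
  have h1 : HasFDerivAt (fun y => ρ y / ε) (ε⁻¹ • fderiv ℝ ρ x) x := by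
    simpa [div_eq_mul_inv, mul_comm] using (hρ x).hasFDerivAt.const_mul ε⁻¹
  have h2 := (hf (ρ x / ε)).hasDerivAt.comp_hasFDerivAt x h1
  have h3 : fderiv ℝ (fun y => f (ρ y / ε)) x = _ := h2.fderiv
  rw [h3]
  simp [div_eq_inv_mul]

/-- The layer `{|ρ| ≤ ε}` around a regular level set has measure `O(ε)`. -/
theorem exists_setIntegral_layer_le {U : Set E3} {ρ χ : E3 → ℝ} {e : E3} (hρ : ContDiff ℝ ∞ ρ)
    (he : ∀ x ∈ U, fderiv ℝ ρ x e ≠ 0) (hχ : IsTestOn U χ) (hχ0 : ∀ x, 0 ≤ χ x) :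
    ∃ C : ℝ, 0 ≤ C ∧ ∀ ε : ℝ, 0 < ε → ∫ x in {x | |ρ x| ≤ ε}, χ x ≤ C * ε := by
  have hq : ContDiff ℝ ∞ fun x => fderiv ℝ ρ x e :=
    (hρ.fderiv_right (m := ∞) (by simp)).clm_apply contDiff_const
  have hg := hχ.div hq he
  set g : E3 → ℝ := fun x => χ x / fderiv ℝ ρ x e with hgdef
  have hg1 : Integrable fun x => fderiv ℝ g x e :=
    (((hg.smooth.continuous_fderiv (by simp)).clm_apply
      continuous_const).integrable_of_hasCompactSupport
        (hg.hasCompactSupport_fderiv_apply fun _ => e))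
  refine ⟨Real.pi * ∫ x, |fderiv ℝ g x e|, by positivity, fun ε hε => ?_⟩
  -- The function `arctan (ρ / ε)` is bounded by `π / 2` uniformly in `ε`, while its `e`-derivative
  -- divided by `∂_e ρ` is at least `1 / (2 ε)` on the layer. Integrating by parts against `g = χ /
  -- ∂_e ρ` therefore bounds the layer integral by `2 ε` times a constant.
  have hθ : ContDiff ℝ ∞ fun x => Real.arctan (ρ x / ε) :=
    Real.contDiff_arctan.comp (hρ.div_const ε)
  have hibp := hg.integral_mul_fderiv hθ e
  have hprod : ∀ x, g x * fderiv ℝ (fun x => Real.arctan (ρ x / ε)) x e =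
      χ x * (1 / (1 + (ρ x / ε) ^ 2)) / ε := by
    intro x
    rw [fderiv_comp_div_apply (hρ.differentiable (by simp)) Real.differentiable_arctan,
      Real.deriv_arctan, hgdef]
    by_cases hx : fderiv ℝ ρ x e = 0
    · have : χ x = 0 := image_eq_zero_of_notMem_tsupport fun h => he x (hχ.support h) hx
      simp [this]
    · field_simp
  simp only [hprod] at hibp
  have hcont : Continuous fun x => χ x * (1 / (1 + (ρ x / ε) ^ 2)) / ε := by
    have h1 := hχ.smooth.continuous
    have h2 := hρ.continuous
    refine (h1.mul (continuous_const.div (by fun_prop) fun x => by positivity)).div_const ε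
  have hint : Integrable fun x => χ x * (1 / (1 + (ρ x / ε) ^ 2)) / ε := by
    refine hcont.integrable_of_hasCompactSupport (hχ.compact.mono fun x hx h => hx (by simp [h]))
  have hmeas : MeasurableSet {x | |ρ x| ≤ ε} :=
    (isClosed_le hρ.continuous.abs continuous_const).measurableSet
  calc ∫ x in {x | |ρ x| ≤ ε}, χ x
      ≤ ∫ x in {x | |ρ x| ≤ ε}, 2 * ε * (χ x * (1 / (1 + (ρ x / ε) ^ 2)) / ε) := by
        refine setIntegral_mono_on
          (hχ.smooth.continuous.integrable_of_hasCompactSupport hχ.compact).integrableOn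
          (hint.const_mul _).integrableOn hmeas fun x hx => ?_
        have h1 : (ρ x / ε) ^ 2 ≤ 1 := by
          rw [sq_le_one_iff_abs_le_one, abs_div, abs_of_pos hε]
          exact div_le_one_of_le₀ hx hε.le
        have h2 : (1 : ℝ) / 2 ≤ 1 / (1 + (ρ x / ε) ^ 2) :=
          one_div_le_one_div_of_le (by positivity) (by linarith)
        have h3 : 2 * ε * (χ x * (1 / (1 + (ρ x / ε) ^ 2)) / ε) =
            χ x * (2 * (1 / (1 + (ρ x / ε) ^ 2))) := by field_simp
        rw [h3]
        exact le_mul_of_one_le_right (hχ0 x) (by linarith)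
    _ ≤ ∫ x, 2 * ε * (χ x * (1 / (1 + (ρ x / ε) ^ 2)) / ε) := by
        refine setIntegral_le_integral (hint.const_mul _) (Filter.Eventually.of_forall fun x => ?_)
        have := hχ0 x
        simp only [Pi.zero_apply]
        positivity
    _ = 2 * ε * -∫ x, fderiv ℝ g x e * Real.arctan (ρ x / ε) := by
        rw [integral_const_mul, hibp]
    _ ≤ 2 * ε * (Real.pi / 2 * ∫ x, |fderiv ℝ g x e|) := by
        refine mul_le_mul_of_nonneg_left ?_ (by positivity)
        refine (neg_le_abs _).trans ?_
        rw [← integral_const_mul, ← Real.norm_eq_abs]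
        refine norm_integral_le_of_norm_le (hg1.abs.const_mul _)
          (Filter.Eventually.of_forall fun x => ?_)
        rw [norm_mul, mul_comm, Real.norm_eq_abs, Real.norm_eq_abs]
        exact mul_le_mul_of_nonneg_right (abs_le.2 ⟨(Real.neg_pi_div_two_lt_arctan _).le,
          (Real.arctan_lt_pi_div_two _).le⟩) (abs_nonneg _)
    _ = Real.pi * (∫ x, |fderiv ℝ g x e|) * ε := by ring

theorem abs_integral_le_of_layer {ρ χ k : E3 → ℝ} {A C ε : ℝ} (hρ : Continuous ρ)
    (hχ : Integrable χ) (hA : 0 ≤ A) (hC : ∫ x in {x | |ρ x| ≤ ε}, χ x ≤ C * ε)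
    (hk : ∀ x, |ρ x| ≤ ε → |k x| ≤ A * χ x) (hk0 : ∀ x, ε < |ρ x| → k x = 0) :
    |∫ x, k x| ≤ A * (C * ε) := by
  have hmeas : MeasurableSet {x | |ρ x| ≤ ε} :=
    (isClosed_le hρ.abs continuous_const).measurableSet
  rw [← setIntegral_eq_integral_of_forall_compl_eq_zero (s := {x | |ρ x| ≤ ε})
    fun x hx => hk0 x (not_le.1 hx), ← Real.norm_eq_abs]
  calc ‖∫ x in {x | |ρ x| ≤ ε}, k x‖ ≤ ∫ x in {x | |ρ x| ≤ ε}, A * χ x :=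
        norm_integral_le_of_norm_le (hχ.const_mul A).integrableOn
          ((ae_restrict_mem hmeas).mono hk)
    _ = A * ∫ x in {x | |ρ x| ≤ ε}, χ x := integral_const_mul _ _
    _ ≤ A * (C * ε) := mul_le_mul_of_nonneg_left hC hA

/-- The layer terms `G η'(ρ/ε)/ε` have vanishing integral in the limit `ε → 0`. -/
theorem tendsto_integral_layer {U : Set E3} (hU : IsOpen U) {ρ G : E3 → ℝ} {e : E3}
    (hρ : ContDiff ℝ ∞ ρ) (he : ∀ x ∈ U, fderiv ℝ ρ x e ≠ 0) (hG : Continuous G)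
    (hGc : HasCompactSupport G) (hGU : tsupport G ⊆ U) {η : ℝ → ℝ} (hη : ContDiff ℝ ∞ η)
    (hηs : ∀ t, 1 < |t| → η t = 0) :
    Filter.Tendsto (fun ε => ∫ x, G x * (deriv η (ρ x / ε) / ε)) (nhdsWithin 0 (Ioi 0))
      (nhds 0) := by
  have hdη : ∀ t, 1 < |t| → deriv η t = 0 := fun t ht => by
    have : η =ᶠ[nhds t] fun _ => 0 := by
      filter_upwards [(isOpen_lt continuous_const continuous_abs).mem_nhds ht] with s hs
      exact hηs s hs
    rw [this.deriv_eq, deriv_const]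
  have hbdd : ∀ f : ℝ → ℝ, Continuous f → (∀ t, 1 < |t| → f t = 0) →
      ∃ M, 0 ≤ M ∧ ∀ t, |f t| ≤ M := by
    intro f hf hf0
    obtain ⟨M, hM⟩ := isCompact_Icc.exists_bound_of_continuousOn (s := Icc (-1) 1) hf.continuousOn
    refine ⟨max M 0, le_max_right _ _, fun t => ?_⟩
    by_cases ht : |t| ≤ 1
    · exact (hM t (abs_le.1 ht)).trans (le_max_left _ _)
    · rw [hf0 t (not_le.1 ht), abs_zero]
      exact le_max_right _ _
  obtain ⟨M, hM0, hM⟩ := hbdd η hη.continuous hηs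
  obtain ⟨M', hM'0, hM'⟩ := hbdd (deriv η) (hη.continuous_deriv (by simp)) hdη
  obtain ⟨χ, hχ, hχ1, hχ0⟩ := exists_isTestOn_eqOn_one hU hGc hGU
  obtain ⟨C, hC0, hC⟩ := exists_setIntegral_layer_le hρ he hχ hχ0
  have hχi : Integrable χ := hχ.smooth.continuous.integrable_of_hasCompactSupport hχ.compact
  have hlarge : ∀ ε : ℝ, 0 < ε → ∀ x, ε < |ρ x| → 1 < |ρ x / ε| := fun ε hε x hx => by
    rwa [abs_div, abs_of_pos hε, one_lt_div hε]
  rw [Metric.tendsto_nhdsWithin_nhds]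
  intro κ hκ
  -- A direct estimate gives only `O(1)`: size `1 / ε` on a layer of measure `O(ε)`. A smooth `h`
  -- close to `G` leaves an error below `κ / 2` uniformly in `ε`; the `+ 1` keeps the denominator
  -- positive when `M' * C = 0`.
  obtain ⟨h, hh, hhG, hsupp⟩ := hG.exists_contDiff_approx ⊤
    (ε := fun _ => κ / (2 * (M' * C + 1))) continuous_const (fun _ => by positivity)
  set κ' := κ / (2 * (M' * C + 1)) with hκ'
  have hκ'0 : 0 < κ' := by positivity
  have hts : tsupport h ⊆ tsupport G := closure_mono hsupp
  have hht : IsTestOn U h := ⟨hh, hGc.mono hsupp, hts.trans hGU⟩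
  have hq : ContDiff ℝ ∞ fun x => fderiv ℝ ρ x e :=
    (hρ.fderiv_right (m := ∞) (by simp)).clm_apply contDiff_const
  have hg := hht.div hq he
  set g : E3 → ℝ := fun x => h x / fderiv ℝ ρ x e with hgdef
  have hgs : tsupport g ⊆ tsupport G := by
    have : Function.support g ⊆ Function.support h := fun x hx h' => hx (by simp [hgdef, h'])
    exact (closure_mono this).trans hts
  obtain ⟨D, hD⟩ := (hg.compact.fderiv ℝ).exists_bound_of_continuous
    (hg.smooth.continuous_fderiv (by simp))
  have hD0 : 0 ≤ D := (norm_nonneg _).trans (hD 0)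
  set A := D * ‖e‖ * M with hA
  have hA0 : 0 ≤ A := by positivity
  refine ⟨κ / (2 * (A * C + 1)), by positivity, fun ε hε hεd => ?_⟩
  have hε : 0 < ε := hε
  have hεκ : A * (C * ε) < κ / 2 := by
    rw [dist_zero_right, Real.norm_eq_abs, abs_of_pos hε, lt_div_iff₀ (by positivity)] at hεd
    nlinarith [mul_nonneg hA0 hC0]
  have hρ' : Continuous fun x => deriv η (ρ x / ε) / ε :=
    ((hη.continuous_deriv (by simp)).comp (hρ.continuous.div_const ε)).div_const ε
  have hsplit : ∫ x, G x * (deriv η (ρ x / ε) / ε) =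
      (∫ x, (G x - h x) * (deriv η (ρ x / ε) / ε)) + ∫ x, h x * (deriv η (ρ x / ε) / ε) := by
    rw [← integral_add]
    · congr 1
      funext x
      ring
    · exact ((hG.sub hh.continuous).mul hρ').integrable_of_hasCompactSupport
        (hGc.sub hht.compact).mul_right
    · exact (hh.continuous.mul hρ').integrable_of_hasCompactSupport hht.compact.mul_right
  have hone : ∀ x ∈ tsupport G, χ x = 1 := fun x hx => hχ1 hx
  have h1 : |∫ x, (G x - h x) * (deriv η (ρ x / ε) / ε)| ≤ κ' * M' / ε * (C * ε) := by
    refine abs_integral_le_of_layer hρ.continuous hχi (by positivity) (hC ε hε) (fun x _ => ?_)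
      fun x hx => by rw [hdη _ (hlarge ε hε x hx), zero_div, mul_zero]
    by_cases hx : x ∈ tsupport G
    · rw [hone x hx, mul_one, abs_mul, abs_div, abs_of_pos hε, mul_div_assoc]
      have := (hhG x).le
      rw [dist_comm, Real.dist_eq] at this
      exact mul_le_mul this (div_le_div_of_nonneg_right (hM' _) hε.le) (by positivity) hκ'0.le
    · rw [image_eq_zero_of_notMem_tsupport hx,
        image_eq_zero_of_notMem_tsupport fun h' => hx (hts h')]
      have := hχ0 x
      simp only [sub_zero, zero_mul, abs_zero]
      positivity
  -- Since `η'(ρ / ε) / ε` is the `e`-derivative of `η (ρ / ε)` divided by `∂_e ρ`, integration by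
  -- parts removes the factor `1 / ε`, and the layer measure alone gives `O(ε)`.
  have h2 : |∫ x, h x * (deriv η (ρ x / ε) / ε)| ≤ A * (C * ε) := by
    have hibp := hg.integral_mul_fderiv (h := fun x => η (ρ x / ε)) (hη.comp (hρ.div_const ε)) e
    have hprod : ∀ x, g x * fderiv ℝ (fun x => η (ρ x / ε)) x e =
        h x * (deriv η (ρ x / ε) / ε) := by
      intro x
      rw [fderiv_comp_div_apply (hρ.differentiable (by simp)) (hη.differentiable (by simp)),
        hgdef]
      by_cases hx : fderiv ℝ ρ x e = 0
      · have : h x = 0 := image_eq_zero_of_notMem_tsupport fun h' => he x (hht.support h') hx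
        simp [this]
      · field_simp
    simp only [hprod] at hibp
    rw [hibp, abs_neg]
    refine abs_integral_le_of_layer hρ.continuous hχi hA0 (hC ε hε) (fun x _ => ?_)
      fun x hx => by rw [hηs _ (hlarge ε hε x hx), mul_zero]
    by_cases hx : x ∈ tsupport G
    · rw [hone x hx, mul_one, abs_mul]
      exact mul_le_mul (((fderiv ℝ g x).le_opNorm e).trans
        (mul_le_mul_of_nonneg_right (hD x) (norm_nonneg e))) (hM _) (abs_nonneg _) (by positivity)
    · have h0 : fderiv ℝ g x = 0 :=
        image_eq_zero_of_notMem_tsupport (fun h' => hx (hgs (tsupport_fderiv_subset ℝ h')))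
      have := hχ0 x
      simp only [h0, zero_apply, zero_mul, abs_zero]
      positivity
  have h3 : κ' * M' / ε * (C * ε) < κ / 2 := by
    have e1 : κ' * M' / ε * (C * ε) = κ' * (M' * C) := by field_simp
    have e2 : κ' * (M' * C + 1) = κ / 2 := by rw [hκ']; field_simp
    rw [e1]
    linarith
  rw [dist_zero_right, Real.norm_eq_abs, hsplit]
  exact (abs_add_le _ _).trans_lt (by linarith)

/-! ### Removability of the boundary -/

/-- A continuous field that is weakly divergence-free off a regular level set is weakly
divergence-free across it. -/
theorem WeakDivFree.of_diff_levelSet {U : Set E3} (hU : IsOpen U) {ρ : E3 → ℝ} {e : E3}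
    {F : E3 → E3} (hρ : ContDiff ℝ ∞ ρ) (he : ∀ x ∈ U, fderiv ℝ ρ x e ≠ 0) (hF : Continuous F)
    (h : WeakDivFree (U \ {x | ρ x = 0}) F) : WeakDivFree U F := by
  intro φ hφ
  -- Being 1 on a whole neighbourhood of 0 makes `1 - β (ρ / ε)` vanish near the level set, so its
  -- product with `φ` is a test function off it.
  let β : ContDiffBump (0 : ℝ) := ⟨1 / 2, 1, by norm_num, by norm_num⟩
  have hβ : ContDiff ℝ ∞ β := β.contDiff
  have hβs : ∀ t, 1 < |t| → β t = 0 := fun t ht => β.zero_of_le_dist (by simpa using ht.le)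
  obtain ⟨χ, hχ, hχ1, hχ0⟩ := exists_isTestOn_eqOn_one hU hφ.compact hφ.support
  obtain ⟨C, hC0, hC⟩ := exists_setIntegral_layer_le hρ he hχ hχ0
  have hχi : Integrable χ := hχ.smooth.continuous.integrable_of_hasCompactSupport hχ.compact
  have hdφ : Continuous fun x => fderiv ℝ φ x (F x) :=
    hφ.continuous_fderiv_apply hU hF.continuousOn
  obtain ⟨D, hD⟩ := (hφ.hasCompactSupport_fderiv_apply F).exists_bound_of_continuous hdφ
  have hD0 : 0 ≤ D := (norm_nonneg _).trans (hD 0)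
  have hGc : Continuous fun x => φ x * fderiv ℝ ρ x (F x) :=
    hφ.smooth.continuous.mul ((hρ.continuous_fderiv (by simp)).clm_apply hF)
  have hlayer := tendsto_integral_layer hU hρ he hGc hφ.compact.mul_right
    (tsupport_mul_subset_left.trans hφ.support) hβ hβs
  -- The part `(1 - β (ρ / ε)) φ` integrates to zero by hypothesis, leaving two layer terms: one
  -- with a bounded integrand, one of the kind treated by `tendsto_integral_layer`.
  have hid : ∀ ε : ℝ, 0 < ε → ∫ x, fderiv ℝ φ x (F x) =
      (∫ x, β (ρ x / ε) * fderiv ℝ φ x (F x)) +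
        ∫ x, φ x * fderiv ℝ ρ x (F x) * (deriv β (ρ x / ε) / ε) := by
    intro ε hε
    have hσ : ContDiff ℝ ∞ fun x => β (ρ x / ε) := hβ.comp (hρ.div_const ε)
    have ht : IsTestOn (U \ {x | ρ x = 0}) fun x => (1 - β (ρ x / ε)) * φ x := by
      refine hφ.mul_left (contDiff_const.sub hσ) fun x hx => ⟨hφ.support hx.2, fun hx0 => ?_⟩
      have hev : (fun x => 1 - β (ρ x / ε)) =ᶠ[nhds x] 0 := by
        have hc : ContinuousAt (fun y => ρ y / ε) x := (hρ.continuous.div_const ε).continuousAt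
        have hx0 : ρ x = 0 := hx0
        have : ∀ᶠ y in nhds x, ρ y / ε ∈ Metric.closedBall (0 : ℝ) (1 / 2) :=
          hc (by simpa [hx0] using Metric.closedBall_mem_nhds (0 : ℝ) (by norm_num))
        filter_upwards [this] with y hy
        simp [β.one_of_mem_closedBall hy]
      exact (notMem_tsupport_iff_eventuallyEq.2 hev) hx.1
    have h0 := h _ ht
    have hd : ∀ x, fderiv ℝ (fun x => (1 - β (ρ x / ε)) * φ x) x (F x) =
        fderiv ℝ φ x (F x) - (β (ρ x / ε) * fderiv ℝ φ x (F x) +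
          φ x * fderiv ℝ ρ x (F x) * (deriv β (ρ x / ε) / ε)) := by
      intro x
      have hσd := hσ.differentiable (by simp) x
      rw [fderiv_fun_mul (hσd.const_sub 1) (hφ.smooth.differentiable (by simp) x),
        fderiv_const_sub]
      simp only [add_apply, smul_apply, neg_apply, smul_eq_mul]
      rw [fderiv_comp_div_apply (hρ.differentiable (by simp)) (hβ.differentiable (by simp))]
      ring
    simp only [hd] at h0
    have hi1 : Integrable fun x => fderiv ℝ φ x (F x) :=
      hφ.integrable_fderiv_apply hU hF.continuousOn
    have hi2 : Integrable fun x => β (ρ x / ε) * fderiv ℝ φ x (F x) :=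
      (hσ.continuous.mul hdφ).integrable_of_hasCompactSupport
        (hφ.hasCompactSupport_fderiv_apply F).mul_left
    have hi3 : Integrable fun x => φ x * fderiv ℝ ρ x (F x) * (deriv β (ρ x / ε) / ε) :=
      (hGc.mul (((hβ.continuous_deriv (by simp)).comp
        (hρ.continuous.div_const ε)).div_const ε)).integrable_of_hasCompactSupport
          hφ.compact.mul_right.mul_right
    have h1 := integral_sub hi1 (hi2.add hi3)
    simp only [Pi.add_apply] at h1
    rw [h1, integral_add hi2 hi3] at h0
    linarith
  have hσlim : Filter.Tendsto (fun ε => ∫ x, β (ρ x / ε) * fderiv ℝ φ x (F x))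
      (nhdsWithin 0 (Ioi 0)) (nhds 0) := by
    have hlim : Filter.Tendsto (fun ε : ℝ => D * (C * ε)) (nhdsWithin 0 (Ioi 0)) (nhds 0) :=
      ((continuous_const.mul (continuous_const.mul continuous_id)).tendsto' 0 0
        (by simp)).mono_left nhdsWithin_le_nhds
    refine squeeze_zero_norm' ?_ hlim
    filter_upwards [self_mem_nhdsWithin] with ε hε
    have hε : 0 < ε := hε
    refine abs_integral_le_of_layer hρ.continuous hχi hD0 (hC ε hε) (fun x _ => ?_) fun x hx => by
      rw [hβs _ (by rwa [abs_div, abs_of_pos hε, one_lt_div hε]), zero_mul]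
    by_cases hx : x ∈ tsupport φ
    · have h1 : χ x = 1 := hχ1 hx
      rw [h1, mul_one, abs_mul, abs_of_nonneg β.nonneg]
      exact (mul_le_of_le_one_left (abs_nonneg _) β.le_one).trans (hD x)
    · have h0 : fderiv ℝ φ x = 0 :=
        image_eq_zero_of_notMem_tsupport (fun h' => hx (tsupport_fderiv_subset ℝ h'))
      have := hχ0 x
      simp only [h0, zero_apply, mul_zero, abs_zero]
      positivity
  have hsum := hσlim.add hlayer
  rw [add_zero] at hsum
  refine tendsto_nhds_unique (tendsto_const_nhds.congr' ?_) hsum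
  filter_upwards [self_mem_nhdsWithin] with ε hε
  exact hid ε hε

/-- Only this inclusion is needed: a test function supported off `{ρ = 0}` is then supported off the
frontier. -/
theorem frontier_inter_subset_zero {Ω U : Set E3} {ρ : E3 → ℝ} (hΩ : IsOpen Ω) (hU : IsOpen U)
    (hρ : ContinuousOn ρ U) (h : Ω ∩ U = {x ∈ U | ρ x < 0}) {x : E3} (hx : x ∈ frontier Ω)
    (hxU : x ∈ U) : ρ x = 0 := by
  have hcont : ContinuousAt ρ x := hρ.continuousAt (hU.mem_nhds hxU)
  refine le_antisymm ?_ (not_lt.1 fun hneg => ?_)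
  · by_contra! hpos
    have hev : ∀ᶠ y in nhds x, y ∈ U ∧ 0 < ρ y :=
      (hU.mem_nhds hxU |> Filter.Eventually.and <| hcont.eventually (lt_mem_nhds hpos))
    obtain ⟨y, ⟨hyU, hy⟩, hyΩ⟩ := mem_closure_iff_nhds.1 hx.1 _ hev
    have : y ∈ {x ∈ U | ρ x < 0} := h ▸ ⟨hyΩ, hyU⟩
    exact lt_asymm hy this.2
  · have : x ∈ Ω ∩ U := h ▸ ⟨hxU, hneg⟩
    exact hx.2 (by rw [hΩ.interior_eq]; exact this.1)

/-- The smooth boundary of a domain is removable for continuous weakly divergence-free fields. -/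
theorem WeakDivFree.of_compl_frontier {Ω : Set E3} (hΩ : IsSmoothBoundedDomain Ω) {F : E3 → E3}
    (hF : Continuous F) (h : WeakDivFree (frontier Ω)ᶜ F) : WeakDivFree univ F := by
  refine .of_locally isOpen_univ hF.continuousOn fun p _ => ?_
  by_cases hp : p ∈ frontier Ω
  swap
  · exact ⟨_, isClosed_frontier.isOpen_compl, hp, h⟩
  obtain ⟨U, ρ, hU, hpU, hρ, hdρ, hΩU⟩ := hΩ.smooth_boundary p hp
  obtain ⟨r, hr, hrU⟩ := Metric.isOpen_iff.1 hU p hpU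
  let β : ContDiffBump p := ⟨r / 4, r / 2, by positivity, by linarith⟩
  have hβU : tsupport β ⊆ U := by
    rw [β.tsupport_eq]
    exact (Metric.closedBall_subset_ball (by simp [β]; linarith)).trans hrU
  -- `ρ` is smooth only on `U`; the bump turns it into a globally smooth function with the same germ
  -- at `p`.
  set σ : E3 → ℝ := fun x => β x * ρ x with hσdef
  have hσ : ContDiff ℝ ∞ σ := contDiff_of_contDiffAt_tsupport fun x hx =>
    β.contDiff.contDiffAt.mul (hρ.contDiffAt (hU.mem_nhds (hβU (tsupport_mul_subset_left hx))))
  have hσρ : ∀ x ∈ Metric.ball p (r / 4), σ x = ρ x := fun x hx => by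
    simp [hσdef, β.one_of_mem_closedBall (Metric.ball_subset_closedBall hx)]
  have hpball : p ∈ Metric.ball p (r / 4) := Metric.mem_ball_self (by positivity)
  have hdσ : fderiv ℝ σ p ≠ 0 := by
    have : σ =ᶠ[nhds p] ρ := by
      filter_upwards [Metric.isOpen_ball.mem_nhds hpball] with x hx using hσρ x hx
    rwa [this.fderiv_eq]
  -- A direction transversal to the boundary at `p` stays transversal nearby, by continuity of the
  -- derivative.
  obtain ⟨e, he⟩ : ∃ e, fderiv ℝ σ p e ≠ 0 := by
    by_contra! hall
    exact hdσ (ContinuousLinearMap.ext hall)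
  have hopen : IsOpen (Metric.ball p (r / 4) ∩ {x | fderiv ℝ σ x e ≠ 0}) :=
    Metric.isOpen_ball.inter (isOpen_ne_fun
      ((hσ.continuous_fderiv (by simp)).clm_apply continuous_const) continuous_const)
  refine ⟨_, hopen, ⟨hpball, he⟩, .of_diff_levelSet hopen hσ (fun x hx => hx.2) hF ?_⟩
  refine fun φ hφ => h φ ⟨hφ.smooth, hφ.compact, hφ.support.trans fun x hx hxΓ => hx.2 ?_⟩
  have hxU : x ∈ U := hrU (Metric.ball_subset_ball (by linarith) hx.1.1)
  exact (hσρ x hx.1.1).trans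
    (frontier_inter_subset_zero hΩ.isOpen hU hρ.continuousOn hΩU hxΓ hxU)

theorem ScalarDivCurl.of_compl_frontier {Ω : Set E3} (hΩ : IsSmoothBoundedDomain Ω) {b : E3 → E3}
    (hb : Continuous b) (h : ScalarDivCurl (frontier Ω)ᶜ b 0) : ScalarDivCurl univ b 0 where
  div_eq := h.div_eq.of_compl_frontier hΩ hb
  curl_eq k φ hφ := by
    have hrot : WeakDivFree (frontier Ω)ᶜ (rotField b (k + 1) (k + 2)) := fun ψ hψ => by
      simpa using h.curl_eq k ψ hψ
    simpa using hrot.of_compl_frontier hΩ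
      (continuousOn_univ.1 (continuousOn_rotField hb.continuousOn _ _)) φ hφ

/-! ### Gluing and conclusion -/

/-- The rate `|x|⁻¹` plays no further role: the Liouville argument uses only convergence to zero. -/
theorem DecaysAtInfinity.tendsto_zero {B : E3 → E3} (h : DecaysAtInfinity B) :
    Filter.Tendsto B (Bornology.cobounded E3) (nhds 0) :=
  h.trans_tendsto (tendsto_inv_atTop_zero.comp tendsto_norm_cobounded_atTop)

theorem WeakDivFree.congr {U : Set E3} {F G : E3 → E3} (h : WeakDivFree U F) (hFG : EqOn F G U) :
    WeakDivFree U G := by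
  intro φ hφ
  rw [← h φ hφ]
  congr 1
  funext x
  by_cases hx : x ∈ tsupport φ
  · rw [hFG (hφ.support hx)]
  · have h0 : fderiv ℝ φ x = 0 :=
      image_eq_zero_of_notMem_tsupport (fun h' => hx (tsupport_fderiv_subset ℝ h'))
    simp [h0]

/-- A point off the frontier lies in one of the open sets `Ω` and `(closure Ω)ᶜ`, so locality of
weak divergence-freeness glues the two sides. -/
theorem ScalarDivCurl.union_zero {Ω : Set E3} (hΩ : IsOpen Ω) {b bm bp : E3 → E3}
    (hb : Continuous b) (hm : ScalarDivCurl Ω bm 0) (hp : ScalarDivCurl (closure Ω)ᶜ bp 0)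
    (hbm : EqOn bm b Ω) (hbp : EqOn bp b (closure Ω)ᶜ) : ScalarDivCurl (frontier Ω)ᶜ b 0 := by
  have hloc : ∀ {F : E3 → E3}, Continuous F → WeakDivFree Ω F → WeakDivFree (closure Ω)ᶜ F →
      WeakDivFree (frontier Ω)ᶜ F := by
    intro F hF h₁ h₂
    refine .of_locally isClosed_frontier.isOpen_compl hF.continuousOn fun x hx => ?_
    by_cases hxΩ : x ∈ Ω
    · exact ⟨Ω, hΩ, hxΩ, h₁⟩
    · refine ⟨_, isClosed_closure.isOpen_compl, fun hcl => hx ⟨hcl, ?_⟩, h₂⟩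
      rwa [hΩ.interior_eq]
  refine ⟨hloc hb (hm.div_eq.congr hbm) (hp.div_eq.congr hbp), fun k φ hφ => ?_⟩
  have hrot : ∀ {V : Set E3} {c : E3 → E3}, ScalarDivCurl V c 0 → EqOn c b V →
      WeakDivFree V (rotField b (k + 1) (k + 2)) := by
    intro V c hc hcb
    refine WeakDivFree.congr (F := rotField c (k + 1) (k + 2))
      (fun ψ hψ => by simpa using hc.curl_eq k ψ hψ) fun x hx => ?_
    simp only [rotField, hcb hx]
  simpa using hloc (continuousOn_univ.1 (continuousOn_rotField hb.continuousOn _ _))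
    (hrot hm hbm) (hrot hp hbp) φ hφ

theorem theorem2 (Ω : Set E3) (hΩ : IsSmoothBoundedDomain Ω) :
    (∀ B : E3 → E3, Continuous B → DivCurl (frontier Ω)ᶜ B 0 → DecaysAtInfinity B →
      ∀ x, B x = 0) ∧
    (∀ J Bin Bm₁ Bp₁ Bm₂ Bp₂ : E3 → E3,
      SolvesTransmission Ω J Bin Bm₁ Bp₁ → SolvesTransmission Ω J Bin Bm₂ Bp₂ →
        Set.EqOn Bm₁ Bm₂ (closure Ω) ∧ Set.EqOn Bp₁ Bp₂ Ωᶜ) := by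
  refine ⟨fun B hB h hdec => ?_, fun J Bin Bm₁ Bp₁ Bm₂ Bp₂ h₁ h₂ => ?_⟩
  · have hs : ScalarDivCurl (frontier Ω)ᶜ B 0 := by
      rcases h with h | h
      · exact h.scalar isClosed_frontier.isOpen_compl locallyIntegrableOn_zero
      · exact h.scalar
    exact (hs.of_compl_frontier hΩ hB).eq_zero hB hdec.tendsto_zero
  · classical
    set bm : E3 → E3 := fun x => Bm₁ x - Bm₂ x with hbm
    set bp : E3 → E3 := fun x => Bp₁ x - Bp₂ x with hbp
    -- Equal jump data make `bm` and `bp` agree on the frontier, so `b` equals `bm` on `closure Ω`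
    -- and `bp` on `Ωᶜ`, two closed sets covering the space; this gives its continuity.
    set b : E3 → E3 := (closure Ω).piecewise bm bp with hbdef
    have hΩo := hΩ.isOpen
    have hjump : ∀ x ∈ frontier Ω, bm x = bp x := fun x hx => by
      have e1 := h₁.jump x hx
      have e2 := h₂.jump x hx
      rw [← e2] at e1
      simp only [hbm, hbp]
      rw [sub_eq_sub_iff_add_eq_add] at e1 ⊢
      rw [e1, add_comm]
    have hbc : EqOn b bm (closure Ω) := fun x hx => piecewise_eq_of_mem _ _ _ hx
    have hbe : EqOn b bp Ωᶜ := fun x hx => by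
      by_cases hcl : x ∈ closure Ω
      · rw [hbc hcl]
        exact hjump x ⟨hcl, by rwa [hΩo.interior_eq]⟩
      · exact piecewise_eq_of_notMem _ _ _ hcl
    have hb : Continuous b := by
      rw [← continuousOn_univ, ← union_compl_self (closure Ω)]
      have hcov : closure Ω ∪ (closure Ω)ᶜ = closure Ω ∪ Ωᶜ := by
        rw [union_compl_self, eq_comm, eq_univ_iff_forall]
        intro x
        by_cases hx : x ∈ Ω
        · exact Or.inl (subset_closure hx)
        · exact Or.inr hx
      rw [hcov]
      exact ((h₁.continuous_int.sub h₂.continuous_int).congr hbc).union_of_isClosed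
        ((h₁.continuous_ext.sub h₂.continuous_ext).congr hbe) isClosed_closure hΩo.isClosed_compl
    have hext : (closure Ω)ᶜ ⊆ Ωᶜ := compl_subset_compl.2 subset_closure
    have hm : ScalarDivCurl Ω bm 0 := h₁.eq_int.scalar_sub hΩo
      (h₁.continuous_int.mono subset_closure) (h₂.continuous_int.mono subset_closure) h₂.eq_int
    have hp : ScalarDivCurl (closure Ω)ᶜ bp 0 := h₁.eq_ext.scalar_sub
      isClosed_closure.isOpen_compl (h₁.continuous_ext.mono hext) (h₂.continuous_ext.mono hext)
      h₂.eq_ext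
    have hs : ScalarDivCurl (frontier Ω)ᶜ b 0 := .union_zero hΩo hb hm hp
      (fun x hx => (hbc (subset_closure hx)).symm) (fun x hx => (hbe (hext hx)).symm)
    have hlim : Filter.Tendsto b (Bornology.cobounded E3) (nhds 0) := by
      have h0 : Filter.Tendsto bp (Bornology.cobounded E3) (nhds 0) := by
        simpa using h₁.decay.tendsto_zero.sub h₂.decay.tendsto_zero
      refine h0.congr' ?_
      have hbd : Ωᶜ ∈ Bornology.cobounded E3 := hΩ.isBounded
      filter_upwards [hbd] with x hx using (hbe hx).symm
    have hzero := (hs.of_compl_frontier hΩ hb).eq_zero hb hlim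
    exact ⟨fun x hx => sub_eq_zero.1 ((hbc hx).symm.trans (hzero x)),
      fun x hx => sub_eq_zero.1 ((hbe hx).symm.trans (hzero x))⟩
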